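/- Let $F$ be the set of finite non-empty subsets of $\mathbb{C}$, with the topology whose basic open sets are $U_{\{O_i\}_{i\in I},N}=\{A\in F : A\cap O_i\neq\emptyset \text{ for all } i\in I,\ A\subseteq N\}$, for $I$ finite and $O_i,N\subseteq\mathbb{C}$ open; such a set is in normal form if $N=\bigcup_{i\in I} O_i$. Let $K$ be a subfield of $\mathbb{R}$ (for instance $\mathbb{Q}$ or $\mathbb{R}$), and let $R$ be the Riesz space over $K$ of functions $\mathbb{C}\to\mathbb{R}$ generated by $1$, $\mathrm{Re}$ and $\mathrm{Im}$, that is, the least $K$-linear space of functions that contains these three and is closed under pointwise maximum and minimum. In the topological model over $F$ (the Heyting-valued model whose truth values are the open subsets of $F$; $U\Vdash\varphi$ means that $U$ is contained in the truth value of $\varphi$), the internal set $R$ consists of the same functions, with the operations inherited from outside, and the truth value of $r=s$ is the union of all $U_{\{O_i\},N}$ such that $r(z)=s(z)$ for all $z\in N$. Internally, $r\le s$ means $r\vee s=s$, and, for $q\in\mathbb{Q}$, $q>r$ means that $r\le p\cdot 1$ for some rational $p<q$. Then $F\Vdash$ "$R$ is a normable Riesz space". That is, $F$ forces: $R$ is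 a Riesz space over $K$; $1$ is a strong unit of $R$ (for each $r\in R$ there is $n\in\mathbb{N}$ with $-n\cdot 1\le r\le n\cdot 1$); $q\mapsto q\cdot 1$ is an order embedding of $\mathbb{Q}$ into $R$; and for each $r\in R$ the set $U(r)=\{q\in\mathbb{Q} : q>r\}$ is a real number, i.e. a located upper cut: it is inhabited, some rational is not in it, $q\in U(r)$ if and only if $p\in U(r)$ for some $p<q$, and whenever $p<q$, either $p\notin U(r)$ or $q\in U(r)$. Moreover, writing $\sup r$ for the internal real number given by $U(r)$: for every $r\in R$, $A\in F$ and $\varepsilon>0$ there are finitely many pairwise disjoint open sets $O_i\subseteq\mathbb{C}$ ($i\in I$) such that the open set $U$ in normal form with positive information $\{O_i\}_{i\in I}$ contains $A$, the numbers $l=\max_{i}\inf_{z\in O_i} r(z)$ and $u=\sup_{z\in\bigcup_i O_i} r(z)$ exist and satisfy $u-l<\varepsilon$, and $U\Vdash l\le \sup r\le u$. -/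

import Mathlib

open TopologicalSpace

noncomputable section

namespace TopModel

/-! ### Heyting-valued sets and their internal logic

Truth values are the elements of a complete Heyting algebra `Ω` (below: the open sets of a space).
Conjunction, disjunction, implication and negation are `⊓`, `⊔`, `⇨`, `ᶜ`. -/

/-- `U ⊩ φ`, for a condition `U` and a statement with truth value `φ`. -/
def Forces {Ω : Type} [Order.Frame Ω] (U φ : Ω) : Prop := U ≤ φ

/-- The truth value of a statement about the ambient universe. -/
def ext {Ω : Type} [Order.Frame Ω] (p : Prop) : Ω := ⨆ _ : p, ⊤

/-- The truth value of a biconditional. -/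
def biImp {Ω : Type} [Order.Frame Ω] (φ ψ : Ω) : Ω := (φ ⇨ ψ) ⊓ (ψ ⇨ φ)

/-- A Heyting-valued set over `Ω`: a collection of names, with an `Ω`-valued equality relation.
The truth value of `x` being a member is that of `x = x`. -/
structure HSet (Ω : Type) [Order.Frame Ω] where
  /-- the names of members -/
  carrier : Type
  /-- the truth value of equality -/
  eq : carrier → carrier → Ω
  symm : ∀ x y, eq x y ≤ eq y x
  trans : ∀ x y z, eq x y ⊓ eq y z ≤ eq x z

namespace HSet

variable {Ω : Type} [Order.Frame Ω]

/-- The truth value of `∀ x ∈ X, φ x`. -/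
def all (X : HSet Ω) (φ : X.carrier → Ω) : Ω := ⨅ x, X.eq x x ⇨ φ x

/-- The truth value of `∃ x ∈ X, φ x`. -/
def ex (X : HSet Ω) (φ : X.carrier → Ω) : Ω := ⨆ x, X.eq x x ⊓ φ x

/-- The canonical image in the model of a set of the ambient universe. -/
abbrev check (Ω : Type) [Order.Frame Ω] (α : Type) : HSet Ω where
  carrier := α
  eq a b := ext (a = b)
  symm a b := iSup_le fun h => le_iSup_of_le h.symm le_rfl
  trans a b c := by
    unfold ext
    rw [iSup_inf_eq]
    refine iSup_le fun h => ?_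
    subst h
    exact inf_le_right

end HSet

/-! ### Internal reals as located upper cuts of rationals -/

section Cuts

variable {Ω : Type} [Order.Frame Ω]

/-- The truth value of `∀ q ∈ ℚ, φ q`. -/
def allQ (φ : ℚ → Ω) : Ω := (HSet.check Ω ℚ).all φ

/-- The truth value of `∃ q ∈ ℚ, φ q`. -/
def exQ (φ : ℚ → Ω) : Ω := (HSet.check Ω ℚ).ex φ

/-- The truth value of: the set `S` of rationals is a real number, given as a located upper cut.
That is: `S` is inhabited; some rational is not in `S`; `q ∈ S` iff `p ∈ S` for some `p < q`;
and whenever `p < q`, either `p ∉ S` or `q ∈ S`. -/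
def isLocatedUpperCut (S : ℚ → Ω) : Ω :=
  exQ S
    ⊓ exQ (fun q => (S q)ᶜ)
    ⊓ allQ (fun q => biImp (S q) (exQ fun p => ext (p < q) ⊓ S p))
    ⊓ allQ (fun p => allQ fun q => ext (p < q) ⇨ ((S p)ᶜ ⊔ S q))

/-- The truth value of: the real number with upper cut `S` is at most `u`. -/
def cutLe (S : ℚ → Ω) (u : ℝ) : Ω := allQ fun q => ext (u < (q : ℝ)) ⇨ S q

/-- The truth value of: the real number with upper cut `S` is at least `l`. -/
def leCut (l : ℝ) (S : ℚ → Ω) : Ω := allQ fun q => S q ⇨ ext (l ≤ (q : ℝ))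

end Cuts

/-! ### Riesz spaces inside the model -/

/-- A set in the model with the operations of a Riesz space over (the image in the model of) `𝕜`,
and a distinguished element `one`.  This is only the signature; the axioms are stated below, as
truth values. -/
structure RieszSig (Ω : Type) [Order.Frame Ω] (𝕜 : Type) where
  /-- the underlying set of the model -/
  X : HSet Ω
  /-- zero vector -/
  zero : X.carrier
  /-- distinguished element -/
  one : X.carrier
  /-- vector addition -/
  add : X.carrier → X.carrier → X.carrier
  /-- scalar multiplication -/
  smul : 𝕜 → X.carrier → X.carrier
  /-- join -/
  sup : X.carrier → X.carrier → X.carrier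
  /-- meet -/
  inf : X.carrier → X.carrier → X.carrier

namespace RieszSig

variable {Ω : Type} [Order.Frame Ω] {𝕜 : Type} [Field 𝕜] [LinearOrder 𝕜] (R : RieszSig Ω 𝕜)

/-- The truth value of `f ≤ g`, that is, of `f ∨ g = g`. -/
def le (f g : R.X.carrier) : Ω := R.X.eq (R.sup f g) g

/-- The truth value of `∀ k ∈ 𝕜, φ k`. -/
def allScalar (φ : 𝕜 → Ω) : Ω := (HSet.check Ω 𝕜).all φ

/-- The constants are members and the operations are well-defined functions. -/
def opsWellDefined : Ω :=
  R.X.eq R.zero R.zero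
    ⊓ R.X.eq R.one R.one
    ⊓ (R.X.all fun f => R.X.all fun f' => R.X.all fun g => R.X.all fun g' =>
        (R.X.eq f f' ⊓ R.X.eq g g') ⇨
          (R.X.eq (R.add f g) (R.add f' g') ⊓ R.X.eq (R.sup f g) (R.sup f' g')
            ⊓ R.X.eq (R.inf f g) (R.inf f' g')))
    ⊓ (allScalar fun k : 𝕜 => R.X.all fun f => R.X.all fun f' =>
        R.X.eq f f' ⇨ R.X.eq (R.smul k f) (R.smul k f'))

/-- The axioms of a vector space over `𝕜`. -/
def vectorSpaceAxioms : Ω :=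
  (R.X.all fun f => R.X.all fun g => R.X.eq (R.add f g) (R.add g f))
    ⊓ (R.X.all fun f => R.X.all fun g => R.X.all fun h =>
        R.X.eq (R.add (R.add f g) h) (R.add f (R.add g h)))
    ⊓ (R.X.all fun f => R.X.eq (R.add f R.zero) f)
    ⊓ (R.X.all fun f => R.X.eq (R.add f (R.smul (-1) f)) R.zero)
    ⊓ (R.X.all fun f => R.X.eq (R.smul 1 f) f)
    ⊓ (allScalar fun k : 𝕜 => allScalar fun l : 𝕜 => R.X.all fun f =>
        R.X.eq (R.smul (k * l) f) (R.smul k (R.smul l f)))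
    ⊓ (allScalar fun k : 𝕜 => allScalar fun l : 𝕜 => R.X.all fun f =>
        R.X.eq (R.smul (k + l) f) (R.add (R.smul k f) (R.smul l f)))
    ⊓ (allScalar fun k : 𝕜 => R.X.all fun f => R.X.all fun g =>
        R.X.eq (R.smul k (R.add f g)) (R.add (R.smul k f) (R.smul k g)))

/-- The axioms of a lattice. -/
def latticeAxioms : Ω :=
  (R.X.all fun f => R.X.all fun g =>
      R.X.eq (R.sup f g) (R.sup g f) ⊓ R.X.eq (R.inf f g) (R.inf g f)
        ⊓ R.X.eq (R.sup f (R.inf f g)) f ⊓ R.X.eq (R.inf f (R.sup f g)) f)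
    ⊓ (R.X.all fun f => R.X.all fun g => R.X.all fun h =>
        R.X.eq (R.sup (R.sup f g) h) (R.sup f (R.sup g h))
          ⊓ R.X.eq (R.inf (R.inf f g) h) (R.inf f (R.inf g h)))

/-- The order is compatible with the vector space structure. -/
def orderAxioms : Ω :=
  (R.X.all fun f => R.X.all fun g => R.X.all fun h =>
      R.le f g ⇨ R.le (R.add f h) (R.add g h))
    ⊓ (allScalar fun k : 𝕜 => R.X.all fun f => R.X.all fun g =>
        (ext (0 ≤ k) ⊓ R.le f g) ⇨ R.le (R.smul k f) (R.smul k g))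

/-- The truth value of: `R` is a Riesz space over `𝕜`. -/
def isRieszSpace : Ω :=
  R.opsWellDefined ⊓ R.vectorSpaceAxioms ⊓ R.latticeAxioms ⊓ R.orderAxioms

/-- The multiple `q · 1` of the distinguished element, for rational `q`. -/
def rat (q : ℚ) : R.X.carrier := R.smul (q : 𝕜) R.one

/-- The truth value of: `1` is a strong unit. -/
def oneIsStrongUnit : Ω :=
  R.X.all fun f => (HSet.check Ω ℕ).ex fun n : ℕ =>
    R.le (R.rat (-(n : ℚ))) f ⊓ R.le f (R.rat (n : ℚ))

/-- The truth value of: `q ↦ q · 1` is an embedding of the ordered set `ℚ` into `R`. -/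
def ratEmbeds : Ω :=
  allQ fun p => allQ fun q => biImp (ext (p ≤ q)) (R.le (R.rat p) (R.rat q))

/-- The set `U(f) = {q ∈ ℚ | q > f}` of the model, where `q > f` is the strict order induced by the
unit: `f ≤ p · 1` for some rational `p < q`. -/
def upperCut (f : R.X.carrier) (q : ℚ) : Ω :=
  exQ fun p => ext (p < q) ⊓ R.le f (R.rat p)

/-- The truth value of: `R` is a normable Riesz space.  That is, `R` is a Riesz space, `1` is a
strong unit of it and induces an embedding of `ℚ`, and for each `f ∈ R` the set `U(f)` is a real
number. -/
def isNormable : Ω :=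
  R.isRieszSpace ⊓ R.oneIsStrongUnit ⊓ R.ratEmbeds
    ⊓ R.X.all fun f => isLocatedUpperCut (R.upperCut f)

end RieszSig

/-! ### The space of finite non-empty sets of complex numbers -/

/-- Finite, non-empty subsets of `ℂ`. -/
def FinSub : Type := {A : Finset ℂ // A.Nonempty}

/-- The set of all `A` that meet each `O i` and are contained in `N`. -/
def basicSet {n : ℕ} (O : Fin n → Opens ℂ) (N : Opens ℂ) : Set FinSub :=
  {A | (∀ i, ∃ z ∈ A.1, z ∈ O i) ∧ ∀ z ∈ A.1, z ∈ N}

/-- The topology in which the sets `basicSet O N` are the basic open sets. -/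
instance : TopologicalSpace FinSub :=
  generateFrom {S | ∃ (n : ℕ) (O : Fin n → Opens ℂ) (N : Opens ℂ), S = basicSet O N}

/-- The basic open set with positive information `O` and negative information `N`. -/
def basicOpen {n : ℕ} (O : Fin n → Opens ℂ) (N : Opens ℂ) : Opens FinSub :=
  ⟨basicSet O N, isOpen_generateFrom_of_mem ⟨n, O, N, rfl⟩⟩

/-- The open set in normal form with positive information `O`. -/
def normalOpen {n : ℕ} (O : Fin n → Opens ℂ) : Opens FinSub := basicOpen O (⨆ i, O i)

/-! ### The Riesz space of functions, outside and inside the model -/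

/-- The Riesz space over `K` of functions `ℂ → ℝ` generated by `1`, `Re` and `Im`: the least
`K`-linear subspace that contains them and is closed under pointwise maximum and minimum. -/
def extR (K : Subfield ℝ) : Submodule K (ℂ → ℝ) :=
  sInf {V | (1 : ℂ → ℝ) ∈ V ∧ Complex.re ∈ V ∧ Complex.im ∈ V ∧
    ∀ f ∈ V, ∀ g ∈ V, f ⊔ g ∈ V ∧ f ⊓ g ∈ V}

theorem one_mem_extR (K : Subfield ℝ) : (1 : ℂ → ℝ) ∈ extR K :=
  Submodule.mem_sInf.2 fun _ hV => hV.1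

theorem sup_inf_mem_extR {K : Subfield ℝ} {f g : ℂ → ℝ} (hf : f ∈ extR K) (hg : g ∈ extR K) :
    f ⊔ g ∈ extR K ∧ f ⊓ g ∈ extR K := by
  simp only [extR, Submodule.mem_sInf] at hf hg ⊢
  exact ⟨fun V hV => (hV.2.2.2 f (hf V hV) g (hg V hV)).1,
    fun V hV => (hV.2.2.2 f (hf V hV) g (hg V hV)).2⟩

/-- The truth value of `r = s`: the union of the basic open sets on whose negative information
the two functions agree. -/
def eqValue (r s : ℂ → ℝ) : Opens FinSub :=
  sSup {U | ∃ (n : ℕ) (O : Fin n → Opens ℂ) (N : Opens ℂ),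
    U = basicOpen O N ∧ ∀ z ∈ N, r z = s z}

theorem mem_eqValue {r s : ℂ → ℝ} {A : FinSub} :
    A ∈ eqValue r s ↔ ∃ N : Opens ℂ, (∀ z ∈ A.1, z ∈ N) ∧ ∀ z ∈ N, r z = s z := by
  constructor
  · intro h
    obtain ⟨U, ⟨n, O, N, rfl, hN⟩, hA⟩ := Opens.mem_sSup.1 h
    exact ⟨N, hA.2, hN⟩
  · rintro ⟨N, hA, hN⟩
    exact Opens.mem_sSup.2 ⟨basicOpen (Fin.elim0 : Fin 0 → Opens ℂ) N,
      ⟨0, _, N, rfl, hN⟩, fun i => i.elim0, hA⟩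

/-- A non-empty basic open set forces `r = s` iff `r` and `s` agree on its negative information. -/
theorem forces_eqValue_iff {n : ℕ} {O : Fin n → Opens ℂ} {N : Opens ℂ}
    (hU : ∃ A, A ∈ basicOpen O N) (r s : ℂ → ℝ) :
    Forces (basicOpen O N) (eqValue r s) ↔ ∀ z ∈ N, r z = s z := by
  classical
  constructor
  · intro h z hz
    obtain ⟨A, hA⟩ := hU
    have hB : (⟨insert z A.1, Finset.insert_nonempty z A.1⟩ : FinSub) ∈ basicOpen O N := by
      refine ⟨fun i => ?_, fun w hw => ?_⟩
      · obtain ⟨w, hw, hwO⟩ := hA.1 i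
        exact ⟨w, Finset.mem_insert_of_mem hw, hwO⟩
      · rcases Finset.mem_insert.1 hw with rfl | hw
        · exact hz
        · exact hA.2 w hw
    obtain ⟨N', hN', hrs⟩ := mem_eqValue.1 (h hB)
    exact hrs z (hN' z (Finset.mem_insert_self z A.1))
  · intro h A hA
    exact mem_eqValue.2 ⟨N, hA.2, h⟩

/-- The underlying set of the Riesz space inside the topological model over `FinSub`: its members
are the functions in `extR K`, with equality as above. -/
def intRSet (K : Subfield ℝ) : HSet (Opens FinSub) where
  carrier := extR K
  eq := fun r s => eqValue r.1 s.1
  symm := by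
    intro r s A hA
    obtain ⟨N, h1, h2⟩ := mem_eqValue.1 hA
    exact mem_eqValue.2 ⟨N, h1, fun z hz => (h2 z hz).symm⟩
  trans := by
    intro r s t A hA
    obtain ⟨N, h1, h2⟩ := mem_eqValue.1 hA.1
    obtain ⟨M, h3, h4⟩ := mem_eqValue.1 hA.2
    exact mem_eqValue.2 ⟨N ⊓ M, fun z hz => ⟨h1 z hz, h3 z hz⟩,
      fun z hz => (h2 z hz.1).trans (h4 z hz.2)⟩

/-- The Riesz space inside the topological model over `FinSub`: the operations are inherited from
the functions outside. -/
def intR (K : Subfield ℝ) : RieszSig (Opens FinSub) K where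
  X := intRSet K
  zero := (0 : extR K)
  one := (⟨1, one_mem_extR K⟩ : extR K)
  add := fun r s : extR K => (r + s : extR K)
  smul := fun (k : K) (r : extR K) => (k • r : extR K)
  sup := fun r s : extR K => (⟨r.1 ⊔ s.1, (sup_inf_mem_extR r.2 s.2).1⟩ : extR K)
  inf := fun r s : extR K => (⟨r.1 ⊓ s.1, (sup_inf_mem_extR r.2 s.2).2⟩ : extR K)

end TopModel

end

/-!
Over any space, a continuous real function `g` defines an internal real number: its upper cut has
`{a | g a < q}` as the truth value of membership of `q`. A condition `A : FinSub` sees a function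
on `ℂ` only through its germ along `A`, so `A` forces `f < q` exactly when `f < q` on `A`, that is,
when `max_A f < q`. Hence `U(f)` is the internal real defined by the continuous function
`A ↦ max_A f`, and its bounds on an open set of conditions are the bounds of that function.
For the approximation, take disjoint neighbourhoods of the points of `A` on each of which `f` varies
by at most `ε / 2`: any value of `f` there exceeds the infimum over its neighbourhood by at most
`ε / 2`, hence also the largest of these infima.
-/

namespace TopModel

open Filter Topology

section Forcing

variable {Ω : Type} [Order.Frame Ω] {U φ ψ : Ω}

theorem forces_inf : Forces U (φ ⊓ ψ) ↔ Forces U φ ∧ Forces U ψ := le_inf_iff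

theorem forces_himp : Forces U (φ ⇨ ψ) ↔ Forces (U ⊓ φ) ψ := le_himp_iff

theorem forces_ext_himp {p : Prop} : Forces U (ext p ⇨ φ) ↔ (p → Forces U φ) := by
  by_cases hp : p <;> simp [ext, Forces, hp]

theorem forces_biImp_of_eq (h : φ = ψ) : Forces U (biImp φ ψ) := by
  simp [Forces, biImp, h]

theorem ext_true : (ext True : Ω) = ⊤ := by simp [ext]

theorem HSet.forces_all_of_eq_self_eq_top {X : HSet Ω} (hX : ∀ x, X.eq x x = ⊤)
    {φ : X.carrier → Ω} : Forces U (X.all φ) ↔ ∀ x, Forces U (φ x) := by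
  simp only [HSet.all, hX, top_himp, Forces, le_iInf_iff]

theorem HSet.forces_check_all {α : Type} {φ : α → Ω} :
    Forces U ((HSet.check Ω α).all φ) ↔ ∀ a, Forces U (φ a) :=
  HSet.forces_all_of_eq_self_eq_top (X := HSet.check Ω α) fun a => by simp only [ext_true]

theorem HSet.check_ex {α : Type} (φ : α → Ω) : (HSet.check Ω α).ex φ = ⨆ a, φ a := by
  simp only [HSet.ex, ext_true, top_inf_eq]

theorem forces_allQ {φ : ℚ → Ω} : Forces U (allQ φ) ↔ ∀ q, Forces U (φ q) :=
  HSet.forces_check_all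

theorem RieszSig.forces_allScalar {𝕜 : Type} {φ : 𝕜 → Ω} :
    Forces U (RieszSig.allScalar φ) ↔ ∀ k, Forces U (φ k) :=
  HSet.forces_check_all

end Forcing

section ContinuousCut

variable {α : Type} [TopologicalSpace α]

theorem mem_ext {p : Prop} {a : α} : a ∈ (ext p : Opens α) ↔ p := by
  simp [ext]

theorem mem_exQ {φ : ℚ → Opens α} {a : α} : a ∈ exQ φ ↔ ∃ q, a ∈ φ q := by
  rw [exQ, HSet.check_ex, Opens.mem_iSup]

/-- The internal real number of the topological model over `α` represented by a continuous function
`g`, as an upper cut: the truth value of `g < q` is the open set on which it holds. -/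
def cutOf (g : C(α, ℝ)) (q : ℚ) : Opens α :=
  ⟨{a | g a < q}, isOpen_lt g.continuous continuous_const⟩

theorem mem_cutOf {g : C(α, ℝ)} {q : ℚ} {a : α} : a ∈ cutOf g q ↔ g a < q := Iff.rfl

theorem mem_compl_cutOf_of_lt {g : C(α, ℝ)} {q : ℚ} {a : α} (h : q < g a) :
    a ∈ (cutOf g q)ᶜ := by
  let V : Opens α := ⟨{b | q < g b}, isOpen_lt continuous_const g.continuous⟩
  have hV : V ≤ (cutOf g q)ᶜ := by
    rw [le_compl_iff_disjoint_right, disjoint_iff_inf_le]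
    exact fun b hb => (lt_asymm (show q < g b from hb.1) hb.2).elim
  exact hV h

theorem cutOf_eq_exQ (g : C(α, ℝ)) (q : ℚ) :
    cutOf g q = exQ fun p => ext (p < q) ⊓ cutOf g p := by
  ext a
  change a ∈ cutOf g q ↔ a ∈ exQ fun p => ext (p < q) ⊓ cutOf g p
  simp only [mem_exQ, Opens.mem_inf, mem_ext, mem_cutOf]
  constructor
  · intro h
    obtain ⟨p, hgp, hpq⟩ := exists_rat_btwn h
    exact ⟨p, Rat.cast_lt.1 hpq, hgp⟩
  · rintro ⟨p, hpq, hgp⟩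
    exact hgp.trans (Rat.cast_lt.2 hpq)

theorem forces_isLocatedUpperCut_cutOf (g : C(α, ℝ)) (U : Opens α) :
    Forces U (isLocatedUpperCut (cutOf g)) := by
  simp only [isLocatedUpperCut, forces_inf, forces_allQ, forces_ext_himp]
  refine ⟨⟨⟨fun a _ => ?_, fun a _ => ?_⟩, fun q => forces_biImp_of_eq (cutOf_eq_exQ g q)⟩,
    fun p q hpq a _ => ?_⟩
  · exact mem_exQ.2 (exists_rat_gt (g a))
  · obtain ⟨q, hq⟩ := exists_rat_lt (g a)
    exact mem_exQ.2 ⟨q, mem_compl_cutOf_of_lt hq⟩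
  · rcases lt_or_ge (g a) q with h | h
    · exact Or.inr h
    · exact Or.inl (mem_compl_cutOf_of_lt ((Rat.cast_lt.2 hpq).trans_le h))

theorem forces_leCut_cutOf {g : C(α, ℝ)} {U : Opens α} {l : ℝ} :
    Forces U (leCut l (cutOf g)) ↔ ∀ a ∈ U, l ≤ g a := by
  simp only [leCut, forces_allQ, forces_himp]
  constructor
  · exact fun h a ha => le_of_forall_lt_rat_imp_le fun q hq => mem_ext.1 (h q ⟨ha, hq⟩)
  · exact fun h q a ha => mem_ext.2 ((h a ha.1).trans (mem_cutOf.1 ha.2).le)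

theorem forces_cutLe_cutOf {g : C(α, ℝ)} {U : Opens α} {u : ℝ} :
    Forces U (cutLe (cutOf g) u) ↔ ∀ a ∈ U, g a ≤ u := by
  simp only [cutLe, forces_allQ, forces_ext_himp]
  constructor
  · exact fun h a ha => le_of_forall_gt_imp_ge_of_dense fun x hx => by
      obtain ⟨q, huq, hqx⟩ := exists_rat_btwn hx
      exact ((mem_cutOf.1 (h q huq ha)).trans hqx).le
  · exact fun h q hq a ha => (h a ha).trans_lt hq

end ContinuousCut

section FiniteSets

theorem isOpen_setOf_forall_mem {N : Set ℂ} (hN : IsOpen N) :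
    IsOpen {A : FinSub | ∀ z ∈ A.1, z ∈ N} := by
  convert (basicOpen (Fin.elim0 : Fin 0 → Opens ℂ) ⟨N, hN⟩).isOpen using 1
  ext A
  exact ⟨fun h => ⟨fun i => i.elim0, h⟩, fun h => h.2⟩

theorem isOpen_setOf_exists_mem {V : Set ℂ} (hV : IsOpen V) :
    IsOpen {A : FinSub | ∃ z ∈ A.1, z ∈ V} := by
  convert (basicOpen (fun _ : Fin 1 => (⟨V, hV⟩ : Opens ℂ)) ⊤).isOpen using 1
  ext A
  exact ⟨fun h => ⟨fun _ => h, fun _ _ => trivial⟩, fun h => h.1 0⟩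

/-- The maximum of a continuous function over a finite set of complex numbers, as a continuous
function of that set. It represents the internal supremum of the function. -/
noncomputable def maxOn (f : C(ℂ, ℝ)) : C(FinSub, ℝ) where
  toFun A := A.1.sup' A.2 f
  continuous_toFun := by
    refine OrderTopology.continuous_iff.2 fun c => ⟨?_, ?_⟩
    · simpa only [Set.preimage, Set.mem_Ioi, Finset.lt_sup'_iff, Set.mem_ofPred_eq] using
        isOpen_setOf_exists_mem (isOpen_lt continuous_const f.continuous)
    · simpa only [Set.preimage, Set.mem_Iio, Finset.sup'_lt_iff, Set.mem_ofPred_eq] using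
        isOpen_setOf_forall_mem (isOpen_lt f.continuous continuous_const)

theorem maxOn_lt_iff {f : C(ℂ, ℝ)} {A : FinSub} {c : ℝ} :
    maxOn f A < c ↔ ∀ z ∈ A.1, f z < c :=
  Finset.sup'_lt_iff A.2

theorem mem_eqValue_iff_eventuallyEq {r s : ℂ → ℝ} {A : FinSub} :
    A ∈ eqValue r s ↔ r =ᶠ[𝓝ˢ (A.1 : Set ℂ)] s := by
  rw [mem_eqValue, EventuallyEq, eventually_nhdsSet_iff_exists]
  exact ⟨fun ⟨N, hA, hN⟩ => ⟨N, N.isOpen, hA, hN⟩, fun ⟨N, ho, hA, hN⟩ => ⟨⟨N, ho⟩, hA, hN⟩⟩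

theorem le_maxOn_of_mem_normalOpen {n : ℕ} {O : Fin n → Opens ℂ} {f : C(ℂ, ℝ)} {m : Fin n → ℝ}
    {l : ℝ} (hm : ∀ i, m i ∈ lowerBounds (f '' (O i : Set ℂ))) (hl : IsLUB (Set.range m) l)
    {B : FinSub} (hB : B ∈ normalOpen O) : l ≤ maxOn f B := by
  refine hl.2 ?_
  rintro _ ⟨i, rfl⟩
  obtain ⟨z, hzB, hzO⟩ := hB.1 i
  exact (hm i ⟨z, hzO, rfl⟩).trans (Finset.le_sup' f hzB)

theorem maxOn_le_of_mem_normalOpen {n : ℕ} {O : Fin n → Opens ℂ} {f : C(ℂ, ℝ)} {u : ℝ}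
    (hu : u ∈ upperBounds (f '' (⋃ i, (O i : Set ℂ)))) {B : FinSub} (hB : B ∈ normalOpen O) :
    maxOn f B ≤ u :=
  Finset.sup'_le B.2 _ fun z hz =>
    hu ⟨z, Set.mem_iUnion.2 (Opens.mem_iSup.1 (hB.2 z hz)), rfl⟩

theorem mem_normalOpen_of_range_eq {n : ℕ} {O : Fin n → Opens ℂ} {a : Fin n → ℂ} {A : FinSub}
    (ha : Set.range a = A.1) (haO : ∀ i, a i ∈ O i) : A ∈ normalOpen O := by
  refine ⟨fun i => ⟨a i, Finset.mem_coe.1 (ha ▸ Set.mem_range_self i), haO i⟩, fun z hz => ?_⟩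
  obtain ⟨i, rfl⟩ := ha.symm.subset hz
  exact Opens.mem_iSup.2 ⟨i, haO i⟩

end FiniteSets

section Oscillation

theorem exists_pairwise_disjoint_opens_dist_lt {ι X Y : Type*} [Finite ι] [TopologicalSpace X]
    [T2Space X] [PseudoMetricSpace Y] {f : X → Y} (hf : Continuous f) {a : ι → X}
    (ha : Function.Injective a) {δ : ℝ} (hδ : 0 < δ) :
    ∃ O : ι → Opens X, Pairwise (fun i j => Disjoint (O i) (O j)) ∧ (∀ i, a i ∈ O i) ∧
      ∀ i, ∀ x ∈ O i, ∀ y ∈ O i, dist (f x) (f y) < δ := by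
  obtain ⟨V, hV, hdisj⟩ := (Set.finite_range a).t2_separation
  let B : ι → Set X := fun i => f ⁻¹' Metric.ball (f (a i)) (δ / 2)
  refine ⟨fun i => ⟨V (a i) ∩ B i, (hV _).2.inter (Metric.isOpen_ball.preimage hf)⟩,
    fun i j hij => ?_, fun i => ⟨(hV _).1, Metric.mem_ball_self (half_pos hδ)⟩,
    fun i x hx y hy => ?_⟩
  · refine Opens.coe_disjoint.1 ?_
    exact (hdisj (Set.mem_range_self i) (Set.mem_range_self j) (ha.ne hij)).mono
      Set.inter_subset_left Set.inter_subset_left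
  · calc dist (f x) (f y) ≤ dist (f x) (f (a i)) + dist (f y) (f (a i)) := dist_triangle_right ..
      _ < δ / 2 + δ / 2 := add_lt_add hx.2 hy.2
      _ = δ := add_halves δ

theorem exists_isGLB_isLUB_sub_le {ι X : Type*} [Finite ι] [Nonempty ι] {f : X → ℝ}
    {S : ι → Set X} (hS : ∀ i, (S i).Nonempty) {δ : ℝ}
    (hδ : ∀ i, ∀ x ∈ S i, ∀ y ∈ S i, dist (f x) (f y) ≤ δ) :
    ∃ (m : ι → ℝ) (l u : ℝ), (∀ i, IsGLB (f '' S i) (m i)) ∧ IsLUB (Set.range m) l ∧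
      IsLUB (f '' ⋃ i, S i) u ∧ u - l ≤ δ := by
  have hlower : ∀ i, ∀ x ∈ S i, f x - δ ∈ lowerBounds (f '' S i) := by
    rintro i x hx _ ⟨y, hy, rfl⟩
    linarith [(abs_le.1 (hδ i x hx y hy)).2]
  have hm : ∀ i, IsGLB (f '' S i) (sInf (f '' S i)) := fun i =>
    isGLB_csInf ((hS i).image f) ((hS i).elim fun x hx => ⟨_, hlower i x hx⟩)
  have hl := isLUB_csSup (Set.range_nonempty _)
    (Set.finite_range fun i => sInf (f '' S i)).bddAbove
  set l := sSup (Set.range fun i => sInf (f '' S i))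
  have hupper : l + δ ∈ upperBounds (f '' ⋃ i, S i) := by
    rintro _ ⟨x, hx, rfl⟩
    obtain ⟨i, hi⟩ := Set.mem_iUnion.1 hx
    exact sub_le_iff_le_add.1 (((hm i).2 (hlower i x hi)).trans (hl.1 ⟨i, rfl⟩))
  have hu := isLUB_csSup ((Set.nonempty_iUnion.2 ⟨Classical.arbitrary ι, hS _⟩).image f)
    ⟨_, hupper⟩
  exact ⟨_, l, _, hm, hl, hu, sub_le_iff_le_add'.2 (hu.2 hupper)⟩

theorem exists_normalOpen_sub_lt {f : ℂ → ℝ} (hf : Continuous f) (A : FinSub) {ε : ℝ}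
    (hε : 0 < ε) :
    ∃ (n : ℕ) (O : Fin n → Opens ℂ) (m : Fin n → ℝ) (l u : ℝ),
      Pairwise (fun i j => Disjoint (O i) (O j)) ∧ A ∈ normalOpen O ∧
      (∀ i, IsGLB (f '' (O i : Set ℂ)) (m i)) ∧ IsLUB (Set.range m) l ∧
      IsLUB (f '' (⋃ i, (O i : Set ℂ))) u ∧ u - l < ε := by
  obtain ⟨n, a, ha, hrange⟩ := A.1.finite_toSet.fin_param
  have : Nonempty (Fin n) := Set.range_nonempty_iff_nonempty.1 (hrange ▸ A.2.to_set)
  obtain ⟨O, hdisj, haO, hosc⟩ := exists_pairwise_disjoint_opens_dist_lt hf ha (half_pos hε)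
  obtain ⟨m, l, u, hm, hl, hu, hlu⟩ := exists_isGLB_isLUB_sub_le (S := fun i => (O i : Set ℂ))
    (fun i => ⟨a i, haO i⟩) fun i x hx y hy => (hosc i x hx y hy).le
  exact ⟨n, O, m, l, u, hdisj, mem_normalOpen_of_range_eq hrange haO, hm, hl, hu,
    hlu.trans_lt (half_lt_self hε)⟩

end Oscillation

section InternalRieszSpace

variable {K : Subfield ℝ} {U : Opens FinSub} {A : FinSub}

theorem continuous_of_mem_extR {f : ℂ → ℝ} (hf : f ∈ extR K) : Continuous f := by
  let V : Submodule K (ℂ → ℝ) :=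
    { carrier := {f | Continuous f}
      add_mem' := Continuous.add
      zero_mem' := continuous_const
      smul_mem' := fun k _ hg => hg.const_smul k }
  exact Submodule.mem_sInf.1 hf V ⟨continuous_const, Complex.continuous_re,
    Complex.continuous_im, fun f hf g hg => ⟨Continuous.sup hf hg, Continuous.inf hf hg⟩⟩

/-- The function on `ℂ` named by a member of the internal Riesz space. -/
def intR.toContinuousMap (f : (intR K).X.carrier) : C(ℂ, ℝ) :=
  ⟨Subtype.val (show extR K from f), continuous_of_mem_extR (Subtype.prop (show extR K from f))⟩

open intR (toContinuousMap)

theorem mem_intR_eq {f g : (intR K).X.carrier} :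
    A ∈ (intR K).X.eq f g ↔ toContinuousMap f =ᶠ[𝓝ˢ (A.1 : Set ℂ)] toContinuousMap g :=
  mem_eqValue_iff_eventuallyEq

theorem mem_intR_le {f g : (intR K).X.carrier} :
    A ∈ (intR K).le f g ↔ toContinuousMap f ≤ᶠ[𝓝ˢ (A.1 : Set ℂ)] toContinuousMap g :=
  mem_eqValue_iff_eventuallyEq.trans (eventually_congr (.of_forall fun _ => sup_eq_right))

theorem intR_eq_self (f : (intR K).X.carrier) : (intR K).X.eq f f = ⊤ :=
  top_unique fun _ _ => mem_intR_eq.2 EventuallyEq.rfl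

theorem forces_intR_all {φ : (intR K).X.carrier → Opens FinSub} :
    Forces U ((intR K).X.all φ) ↔ ∀ f, Forces U (φ f) :=
  HSet.forces_all_of_eq_self_eq_top intR_eq_self

theorem forces_intR_eq_of_eq {f g : (intR K).X.carrier} (h : f = g) :
    Forces U ((intR K).X.eq f g) := by
  rw [h, intR_eq_self]
  exact le_top

theorem forces_intR_opsWellDefined : Forces U (intR K).opsWellDefined := by
  simp only [RieszSig.opsWellDefined, forces_inf, forces_intR_all, RieszSig.forces_allScalar,
    forces_himp]
  refine ⟨⟨⟨forces_intR_eq_of_eq rfl, forces_intR_eq_of_eq rfl⟩,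
    fun f f' g g' => ⟨⟨fun A hA => ?_, fun A hA => ?_⟩, fun A hA => ?_⟩⟩, fun k f f' A hA => ?_⟩
  · exact mem_intR_eq.2 ((mem_intR_eq.1 hA.2.1).add (mem_intR_eq.1 hA.2.2))
  · exact mem_intR_eq.2 ((mem_intR_eq.1 hA.2.1).sup (mem_intR_eq.1 hA.2.2))
  · exact mem_intR_eq.2 ((mem_intR_eq.1 hA.2.1).inf (mem_intR_eq.1 hA.2.2))
  · exact mem_intR_eq.2 ((mem_intR_eq.1 hA.2).const_smul k)

theorem forces_intR_vectorSpaceAxioms : Forces U (intR K).vectorSpaceAxioms := by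
  simp only [RieszSig.vectorSpaceAxioms, forces_inf, forces_intR_all, RieszSig.forces_allScalar]
  refine ⟨⟨⟨⟨⟨⟨⟨fun (f g : extR K) => ?_, fun (f g h : extR K) => ?_⟩, fun (f : extR K) => ?_⟩,
    fun (f : extR K) => ?_⟩, fun (f : extR K) => ?_⟩, fun k l (f : extR K) => ?_⟩,
    fun k l (f : extR K) => ?_⟩, fun k (f g : extR K) => ?_⟩ <;> apply forces_intR_eq_of_eq
  · exact add_comm f g
  · exact add_assoc f g h
  · exact add_zero f
  · exact (congrArg (f + ·) (neg_one_smul K f)).trans (add_neg_cancel f)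
  · exact one_smul K f
  · exact mul_smul k l f
  · exact add_smul k l f
  · exact smul_add k f g

theorem forces_intR_latticeAxioms : Forces U (intR K).latticeAxioms := by
  simp only [RieszSig.latticeAxioms, forces_inf, forces_intR_all]
  refine ⟨fun f g => ⟨⟨⟨?_, ?_⟩, ?_⟩, ?_⟩, fun f g h => ⟨?_, ?_⟩⟩ <;>
    refine forces_intR_eq_of_eq (Subtype.ext ?_)
  · exact sup_comm f.1 g.1
  · exact inf_comm f.1 g.1
  · exact sup_inf_self
  · exact inf_sup_self
  · exact sup_assoc f.1 g.1 h.1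
  · exact inf_assoc f.1 g.1 h.1

theorem forces_intR_orderAxioms : Forces U (intR K).orderAxioms := by
  simp only [RieszSig.orderAxioms, forces_inf, forces_intR_all, RieszSig.forces_allScalar,
    forces_himp]
  refine ⟨fun f g h A hA => mem_intR_le.2 ?_, fun k f g A hA => mem_intR_le.2 ?_⟩
  · exact (mem_intR_le.1 hA.2).mono fun z hz => add_le_add_left hz (toContinuousMap h z)
  · have hk : (0 : ℝ) ≤ k := mem_ext.1 hA.2.1
    exact (mem_intR_le.1 hA.2.2).mono fun z hz => mul_le_mul_of_nonneg_left hz hk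

theorem forces_intR_isRieszSpace : Forces U (intR K).isRieszSpace := by
  simp only [RieszSig.isRieszSpace, forces_inf]
  exact ⟨⟨⟨forces_intR_opsWellDefined, forces_intR_vectorSpaceAxioms⟩,
    forces_intR_latticeAxioms⟩, forces_intR_orderAxioms⟩

theorem toContinuousMap_intR_rat (q : ℚ) :
    toContinuousMap ((intR K).rat q) = .const ℂ (q : ℝ) := by
  ext z
  change ((q : K) : ℝ) * 1 = q
  simp

theorem mem_intR_le_rat_of_forall_lt {f : (intR K).X.carrier} {q : ℚ}
    (h : ∀ z ∈ A.1, toContinuousMap f z < q) :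
    A ∈ (intR K).le f ((intR K).rat q) := by
  rw [mem_intR_le, toContinuousMap_intR_rat]
  exact eventually_nhdsSet_iff_forall.2 fun z hz =>
    (map_continuousAt _ z).eventually_le_const (h z hz)

theorem mem_intR_rat_le_of_forall_lt {f : (intR K).X.carrier} {q : ℚ}
    (h : ∀ z ∈ A.1, q < toContinuousMap f z) :
    A ∈ (intR K).le ((intR K).rat q) f := by
  rw [mem_intR_le, toContinuousMap_intR_rat]
  exact eventually_nhdsSet_iff_forall.2 fun z hz =>
    (map_continuousAt _ z).eventually_const_le (h z hz)

theorem forces_intR_oneIsStrongUnit : Forces U (intR K).oneIsStrongUnit := by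
  simp only [RieszSig.oneIsStrongUnit, forces_intR_all, HSet.check_ex]
  intro f A _
  obtain ⟨n, hn⟩ : ∃ n : ℕ, ∀ z ∈ A.1, |toContinuousMap f z| < n :=
    (A.1.eventually_all.2 fun z _ =>
      tendsto_natCast_atTop_atTop.eventually_gt_atTop |toContinuousMap f z|).exists
  refine Opens.mem_iSup.2 ⟨n, mem_intR_rat_le_of_forall_lt fun z hz => ?_,
    mem_intR_le_rat_of_forall_lt fun z hz => ?_⟩
  · exact_mod_cast (abs_lt.1 (hn z hz)).1
  · exact_mod_cast (abs_lt.1 (hn z hz)).2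

theorem mem_intR_rat_le_rat {p q : ℚ} :
    A ∈ (intR K).le ((intR K).rat p) ((intR K).rat q) ↔ p ≤ q := by
  have : (𝓝ˢ (A.1 : Set ℂ)).NeBot := nhdsSet_neBot_iff.2 A.2
  rw [mem_intR_le, toContinuousMap_intR_rat, toContinuousMap_intR_rat]
  exact eventually_const.trans Rat.cast_le

theorem forces_intR_ratEmbeds : Forces U (intR K).ratEmbeds := by
  simp only [RieszSig.ratEmbeds, forces_allQ]
  exact fun p q => forces_biImp_of_eq
    (SetLike.ext fun A => mem_ext.trans mem_intR_rat_le_rat.symm)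

theorem intR_upperCut_eq_cutOf (f : (intR K).X.carrier) :
    (intR K).upperCut f = cutOf (maxOn (toContinuousMap f)) := by
  funext q
  refine SetLike.ext fun A => mem_exQ.trans ?_
  simp only [Opens.mem_inf, mem_ext]
  constructor
  · rintro ⟨p, hpq, hfp⟩
    rw [mem_intR_le, toContinuousMap_intR_rat] at hfp
    exact maxOn_lt_iff.2 fun z hz =>
      (hfp.self_of_nhdsSet z hz).trans_lt (Rat.cast_lt.2 hpq)
  · intro h
    obtain ⟨p, hfp, hpq⟩ := exists_rat_btwn (mem_cutOf.1 h)
    exact ⟨p, Rat.cast_lt.1 hpq, mem_intR_le_rat_of_forall_lt (maxOn_lt_iff.1 hfp)⟩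

theorem forces_leCut_intR_upperCut {f : (intR K).X.carrier} {l : ℝ} :
    Forces U (leCut l ((intR K).upperCut f)) ↔ ∀ A ∈ U, l ≤ maxOn (toContinuousMap f) A := by
  rw [intR_upperCut_eq_cutOf, forces_leCut_cutOf]

theorem forces_cutLe_intR_upperCut {f : (intR K).X.carrier} {u : ℝ} :
    Forces U (cutLe ((intR K).upperCut f) u) ↔ ∀ A ∈ U, maxOn (toContinuousMap f) A ≤ u := by
  rw [intR_upperCut_eq_cutOf, forces_cutLe_cutOf]

theorem forces_intR_isNormable : Forces U (intR K).isNormable := by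
  simp only [RieszSig.isNormable, forces_inf, forces_intR_all, intR_upperCut_eq_cutOf]
  exact ⟨⟨⟨forces_intR_isRieszSpace, forces_intR_oneIsStrongUnit⟩, forces_intR_ratEmbeds⟩,
    fun f => forces_isLocatedUpperCut_cutOf _ U⟩

end InternalRieszSpace

end TopModel

theorem proposition9 (K : Subfield ℝ) :
    TopModel.Forces (⊤ : TopologicalSpace.Opens TopModel.FinSub) (TopModel.intR K).isNormable ∧
    ∀ (r : TopModel.extR K) (A : TopModel.FinSub) (ε : ℝ), 0 < ε →
      ∃ (n : ℕ) (O : Fin n → TopologicalSpace.Opens ℂ) (m : Fin n → ℝ) (l u : ℝ),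
        Pairwise (fun i j => Disjoint (O i) (O j)) ∧
        A ∈ TopModel.normalOpen O ∧
        (∀ i, IsGLB (r.1 '' (O i : Set ℂ)) (m i)) ∧
        IsLUB (Set.range m) l ∧
        IsLUB (r.1 '' (⋃ i, (O i : Set ℂ))) u ∧
        u - l < ε ∧
        TopModel.Forces (TopModel.normalOpen O)
          (TopModel.leCut l ((TopModel.intR K).upperCut r)) ∧
        TopModel.Forces (TopModel.normalOpen O)
          (TopModel.cutLe ((TopModel.intR K).upperCut r) u) := by
  refine ⟨TopModel.forces_intR_isNormable, fun r A ε hε => ?_⟩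
  obtain ⟨n, O, m, l, u, hdisj, hA, hm, hl, hu, hlu⟩ :=
    TopModel.exists_normalOpen_sub_lt (TopModel.continuous_of_mem_extR r.2) A hε
  exact ⟨n, O, m, l, u, hdisj, hA, hm, hl, hu, hlu,
    TopModel.forces_leCut_intR_upperCut.2 fun _ =>
      TopModel.le_maxOn_of_mem_normalOpen (fun i => (hm i).1) hl,
    TopModel.forces_cutLe_intR_upperCut.2 fun _ =>
      TopModel.maxOn_le_of_mem_normalOpen hu.1⟩
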